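/- Multigraphs here are undirected or directed, may have parallel edges and loops, and need not be finite. For $X \subseteq V(G)$, an *$X$-path* in $G$ is a path $v_0 e_1 v_1 \dots e_\ell v_\ell$ with $\ell \ge 1$ and distinct vertices (a directed path, each $e_i$ going from $v_{i-1}$ to $v_i$, if $G$ is directed) such that $v_0, v_\ell \in X$ and $v_1, \dots, v_{\ell-1} \notin X$. Paths are *disjoint* if they have no common vertex. $G - Y$ denotes the multigraph obtained from $G$ by deleting the vertices in $Y$ together with all edges that have an endvertex in $Y$. **Corollary 5.2.** Let $G$ be an undirected or a directed multigraph, let $X \subseteq V(G)$, and let $k \ge 0$ be an integer. Then there exists a set of $k$ pairwise disjoint $X$-paths in $G$, or there exists a vertex set $Y \subseteq V(G)$ with $|Y| \le 2k - 2$ such that $G - Y$ contains no $X$-path. -/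

import Mathlib

universe u v

/-- A directed multigraph with vertices in `α` and edges in `β`, in the style of Mathlib's
undirected multigraphs `Graph α β`: `D.IsArc e x y` says that the edge `e` goes from its initial
vertex `x` to its terminal vertex `y`. Parallel edges (with the same or with opposite directions)
and loops are allowed. -/
structure MultiDigraph (α : Type u) (β : Type v) where
  /-- The vertex set. -/
  vertexSet : Set α
  /-- The edge set. -/
  edgeSet : Set β
  /-- `IsArc e x y`: the edge `e` goes from `x` to `y`. -/
  IsArc : β → α → α → Prop
  /-- The edges are exactly the elements of `β` that have an initial and a terminal vertex. -/
  edge_mem_iff_exists_isArc : ∀ e, e ∈ edgeSet ↔ ∃ x y, IsArc e x y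
  /-- The initial and the terminal vertex of an edge are unique. -/
  eq_and_eq_of_isArc : ∀ ⦃e x y x' y'⦄, IsArc e x y → IsArc e x' y' → x = x' ∧ y = y'
  /-- The initial vertex of an edge is a vertex. -/
  left_mem_of_isArc : ∀ ⦃e x y⦄, IsArc e x y → x ∈ vertexSet
  /-- The terminal vertex of an edge is a vertex. -/
  right_mem_of_isArc : ∀ ⦃e x y⦄, IsArc e x y → y ∈ vertexSet

/-- The directed multigraph `D - Y`: delete the vertices in `Y` and all edges that have their
initial or their terminal vertex in `Y`. -/
def MultiDigraph.deleteVerts {α : Type u} {β : Type v} (D : MultiDigraph α β) (Y : Set α) :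
    MultiDigraph α β where
  vertexSet := D.vertexSet \ Y
  edgeSet := {e | ∃ x y, D.IsArc e x y ∧ x ∉ Y ∧ y ∉ Y}
  IsArc e x y := D.IsArc e x y ∧ x ∉ Y ∧ y ∉ Y
  edge_mem_iff_exists_isArc _ := Iff.rfl
  eq_and_eq_of_isArc _ _ _ _ _ h h' := D.eq_and_eq_of_isArc h.1 h'.1
  left_mem_of_isArc _ _ _ h := ⟨D.left_mem_of_isArc h.1, h.2.1⟩
  right_mem_of_isArc _ _ _ h := ⟨D.right_mem_of_isArc h.1, h.2.2⟩

/-- A path `v₀ e₁ v₁ … e_ℓ v_ℓ` with distinct vertices `vᵢ ∈ V`, where `link e x y` says that the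
edge `e` may be traversed from `x` to `y`. -/
structure MultiPath {α : Type u} {β : Type v} (V : Set α) (link : β → α → α → Prop) where
  /-- The number `ℓ` of edges. -/
  length : ℕ
  /-- The vertices `v₀, …, v_ℓ`. -/
  vert : Fin (length + 1) → α
  /-- The edges `e₁, …, e_ℓ`, indexed from `0`. -/
  edge : Fin length → β
  vert_mem : ∀ i, vert i ∈ V
  vert_injective : Function.Injective vert
  link_edge : ∀ i, link (edge i) (vert i.castSucc) (vert i.succ)

namespace MultiPath

variable {α : Type u} {β : Type v} {V : Set α} {link : β → α → α → Prop}

/-- The set of vertices of a path. -/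
def support (P : MultiPath V link) : Set α := Set.range P.vert

/-- `P` is an `X`-path: it is non-trivial, its two endvertices lie in `X`, and `X` contains no
other vertex of `P`. -/
def IsXPath (P : MultiPath V link) (X : Set α) : Prop :=
  0 < P.length ∧ P.vert 0 ∈ X ∧ P.vert (Fin.last P.length) ∈ X ∧
    ∀ i, P.vert i ∈ X → i = 0 ∨ i = Fin.last P.length

end MultiPath

/-- Paths in an undirected multigraph: each edge `e_{i+1}` has the ends `v_i` and `v_{i+1}`. -/
abbrev Graph.Path {α : Type u} {β : Type v} (G : Graph α β) :=
  MultiPath G.vertexSet G.IsLink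

/-- (Directed) paths in a directed multigraph: each edge `e_{i+1}` goes from `v_i` to
`v_{i+1}`. -/
abbrev MultiDigraph.Path {α : Type u} {β : Type v} (D : MultiDigraph α β) :=
  MultiPath D.vertexSet D.IsArc

/-
Split every vertex outside `X` into an out-copy and an in-copy, and let an edge from `u` to `v` join
the out-copy of `u` to the in-copy of `v`. The matching of the two copies of each vertex leaves
exactly `X` unmatched, and the `X`-paths are its augmenting paths. Suppose first that the graph is
finite with `2 * k ≤ |X|`. If some other matching misses at most `|X| - 2 * k` vertices, then `k`
components of the union of the two matchings are paths between two vertices of `X`, and they give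
disjoint `X`-paths. Otherwise, the Tutte–Berge formula provides a set whose deletion leaves many odd
components. Each of these contains a vertex that the matching of the copies leaves unmatched or
matches into the deleted set. If one such vertex of each component is spared, then the other ones,
together with the ends of the matching edges inside the deleted set, are at most `2 * k - 2`
vertices meeting all augmenting paths. Infinite graphs follow by compactness: if every finite
subfamily of a family of finite sets has a transversal with at most `n` points, then so has the
whole family.
-/

open Function (Involutive Injective comp_apply)

/-- A packing of a hypergraph `𝓕`: finitely many pairwise disjoint members of `𝓕`. -/
def IsPacking {α : Type*} (𝓕 : Set (Set α)) (𝓟 : Finset (Set α)) : Prop :=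
  ↑𝓟 ⊆ 𝓕 ∧ (𝓟 : Set (Set α)).PairwiseDisjoint id

/-- A transversal (or hitting set) of a hypergraph `𝓕`: a set that meets every member of `𝓕`. -/
def IsTransversal {α : Type*} (𝓕 : Set (Set α)) (T : Set α) : Prop :=
  ∀ F ∈ 𝓕, (F ∩ T).Nonempty

/-- The Erdős–Pósa alternative for a hypergraph `𝓕`: either `𝓕` has `k` disjoint members, or at
most `n` points meet all its members. -/
def HasPackingOrTransversal {α : Type*} (𝓕 : Set (Set α)) (k n : ℕ) : Prop :=
  (∃ 𝓟, IsPacking 𝓕 𝓟 ∧ 𝓟.card = k) ∨ ∃ T : Finset α, T.card ≤ n ∧ IsTransversal 𝓕 T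

section Hypergraph

variable {α γ : Type*} {𝓕 𝓖 : Set (Set α)} {k n : ℕ}

theorem IsPacking.mono {𝓟 : Finset (Set α)} (h : IsPacking 𝓖 𝓟) (h𝓖 : 𝓖 ⊆ 𝓕) : IsPacking 𝓕 𝓟 :=
  ⟨h.1.trans h𝓖, h.2⟩

theorem HasPackingOrTransversal.image {𝓕 : Set (Set γ)} (h : HasPackingOrTransversal 𝓕 k n)
    {ι : γ → α} (hι : Injective ι) : HasPackingOrTransversal (Set.image ι '' 𝓕) k n := by
  classical
  rcases h with ⟨𝓟, ⟨h𝓟, hdisj⟩, hk⟩ | ⟨T, hT, hT𝓕⟩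
  · refine Or.inl ⟨𝓟.image (Set.image ι), ⟨?_, ?_⟩, ?_⟩
    · rw [Finset.coe_image]
      exact Set.image_mono h𝓟
    · rw [Finset.coe_image]
      rintro _ ⟨A, hA, rfl⟩ _ ⟨B, hB, rfl⟩ hAB
      exact (Set.disjoint_image_iff hι).2 (hdisj hA hB (ne_of_apply_ne _ hAB))
    · rw [Finset.card_image_of_injective _ hι.image_injective, hk]
  · refine Or.inr ⟨T.image ι, Finset.card_image_le.trans hT, ?_⟩
    rintro _ ⟨F, hF, rfl⟩
    rw [Finset.coe_image, ← Set.image_inter hι]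
    exact (hT𝓕 F hF).image ι

theorem exists_isTransversal_of_forall_finite (hfin : ∀ F ∈ 𝓕, F.Finite)
    (h : ∀ 𝓖 ⊆ 𝓕, 𝓖.Finite → ∃ T : Finset α, T.card ≤ n ∧ IsTransversal 𝓖 T) :
    ∃ T : Finset α, T.card ≤ n ∧ IsTransversal 𝓕 T := by
  classical
  induction n generalizing 𝓕 with
  | zero =>
    refine ⟨∅, le_rfl, fun F hF => ?_⟩
    obtain ⟨T, hT, hTF⟩ := h {F} (by simpa using hF) (Set.finite_singleton F)
    obtain rfl := Finset.card_eq_zero.1 (Nat.le_zero.1 hT)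
    exact hTF F rfl
  | succ n ih =>
    rcases 𝓕.eq_empty_or_nonempty with rfl | ⟨A, hA⟩
    · exact ⟨∅, Nat.zero_le _, fun _ hF => hF.elim⟩
    by_contra! hno
    -- Deleting a point `v` leaves a finite bad subfamily `𝓖 v`; those for `v ∈ A`, together with
    -- `A` itself, form a finite bad subfamily of `𝓕`.
    have hbad (v : α) : ∃ 𝓖 ⊆ {F ∈ 𝓕 | v ∉ F}, 𝓖.Finite ∧
        ∀ T : Finset α, T.card ≤ n → ¬ IsTransversal 𝓖 T := by
      by_contra! hgood
      obtain ⟨T, hT, hTF⟩ := ih (fun F hF => hfin F hF.1) hgood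
      refine hno (insert v T) ((Finset.card_insert_le _ _).trans (by omega)) fun F hF => ?_
      rw [Finset.coe_insert]
      by_cases hvF : v ∈ F
      · exact ⟨v, hvF, Set.mem_insert _ _⟩
      · exact (hTF F ⟨hF, hvF⟩).mono (Set.inter_subset_inter_right _ (Set.subset_insert _ _))
    choose 𝓖 hsub h𝓖fin h𝓖 using hbad
    obtain ⟨T, hT, hTF⟩ := h (insert A (⋃ v ∈ A, 𝓖 v))
      (Set.insert_subset hA (Set.iUnion₂_subset fun v _ => (hsub v).trans (Set.sep_subset _ _)))
      (((hfin A hA).biUnion fun v _ => h𝓖fin v).insert A)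
    obtain ⟨v, hvA, hvT⟩ := hTF A (Set.mem_insert _ _)
    rw [Finset.mem_coe] at hvT
    refine h𝓖 v (T.erase v) (by rw [Finset.card_erase_of_mem hvT]; omega) fun F hF => ?_
    obtain ⟨w, hwF, hwT⟩ := hTF F (Set.mem_insert_of_mem _ (Set.mem_biUnion hvA hF))
    have hwv : w ≠ v := ne_of_mem_of_not_mem hwF (hsub v hF).2
    exact ⟨w, hwF, Finset.mem_erase.2 ⟨hwv, hwT⟩⟩

theorem hasPackingOrTransversal_of_forall_finite (hfin : ∀ F ∈ 𝓕, F.Finite)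
    (h : ∀ U : Set α, U.Finite → HasPackingOrTransversal {F ∈ 𝓕 | F ⊆ U} k n) :
    HasPackingOrTransversal 𝓕 k n := by
  refine or_iff_not_imp_left.2 fun hno => exists_isTransversal_of_forall_finite hfin ?_
  intro 𝓖 h𝓖 h𝓖fin
  rcases h (⋃₀ 𝓖) (h𝓖fin.sUnion fun F hF => hfin F (h𝓖 hF)) with ⟨𝓟, h𝓟, hk⟩ | ⟨T, hT, hT𝓕⟩
  · exact absurd ⟨𝓟, h𝓟.mono (Set.sep_subset _ _), hk⟩ hno
  · exact ⟨T, hT, fun F hF => hT𝓕 F ⟨h𝓖 hF, Set.subset_sUnion_of_mem hF⟩⟩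

end Hypergraph

section Involutions

variable {W : Type*} {σ μ : Equiv.Perm W} {x y : W} {m n : ℤ}

theorem zpow_apply_eq_zpow_apply_iff (f : Equiv.Perm W) :
    (f ^ m) x = (f ^ n) x ↔ (MulAction.period f x : ℤ) ∣ m - n := by
  rw [← MulAction.zpow_smul_eq_iff_period_dvd, Equiv.Perm.smul_def, sub_eq_neg_add, zpow_add,
    Equiv.Perm.mul_apply, zpow_neg, Equiv.Perm.inv_eq_iff_eq, eq_comm]

theorem apply_zpow_mul_apply (hσ : Involutive σ) (hμ : Involutive μ) (n : ℤ) (x : W) :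
    σ (((σ * μ) ^ n) x) = ((σ * μ) ^ (-n)) (σ x) := by
  have hσ_inv : σ⁻¹ = σ := Equiv.ext fun w => σ.injective (by simp [hσ w])
  have hμ_inv : μ⁻¹ = μ := Equiv.ext fun w => μ.injective (by simp [hμ w])
  have hconj : σ * (σ * μ) * σ⁻¹ = (σ * μ)⁻¹ := by
    rw [mul_inv_rev, hσ_inv, hμ_inv, mul_assoc σ (σ * μ), mul_assoc σ μ]
    ext w
    simp [hσ _]
  rw [zpow_neg, ← inv_zpow, ← hconj, conj_zpow]
  simp

-- From here on `x` is fixed by `σ`, so that by the previous lemma `σ` and `μ` act on the cycle of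
-- `x` under `σ * μ`, a copy of `ℤ / N`, as the reflections `n ↦ -n` and `n ↦ -n - 1`.

theorem apply_zpow_apply_eq_zpow_apply_iff (hσ : Involutive σ) (hμ : Involutive μ) (hx : σ x = x) :
    σ (((σ * μ) ^ m) x) = ((σ * μ) ^ n) x ↔ (MulAction.period (σ * μ) x : ℤ) ∣ m + n := by
  rw [apply_zpow_mul_apply hσ hμ, hx, zpow_apply_eq_zpow_apply_iff, ← dvd_neg]
  ring_nf

theorem right_apply_zpow_apply_eq_self_iff (hσ : Involutive σ) (hμ : Involutive μ)
    (hx : σ x = x) :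
    μ (((σ * μ) ^ n) x) = ((σ * μ) ^ n) x ↔ (MulAction.period (σ * μ) x : ℤ) ∣ 2 * n + 1 := by
  rw [← σ.injective.eq_iff, ← Equiv.Perm.mul_apply, ← Equiv.Perm.mul_apply, ← zpow_one_add, eq_comm,
    apply_zpow_apply_eq_zpow_apply_iff hσ hμ hx]
  ring_nf

theorem eq_or_eq_of_sameCycle (hσ : Involutive σ) (hμ : Involutive μ) (hx : σ x = x) (hy : σ y = y)
    {j : ℕ} (hj : MulAction.period (σ * μ) x = 2 * j) (hxy : (σ * μ).SameCycle x y) :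
    y = x ∨ y = ((σ * μ) ^ j) x := by
  obtain ⟨n, rfl⟩ := hxy
  rw [apply_zpow_apply_eq_zpow_apply_iff hσ hμ hx, hj, ← two_mul, Nat.cast_mul, Nat.cast_two,
    mul_dvd_mul_iff_left two_ne_zero] at hy
  obtain ⟨q, rfl⟩ := hy
  obtain ⟨q, rfl | rfl⟩ := q.even_or_odd'
  · left
    have hdvd : (MulAction.period (σ * μ) x : ℤ) ∣ j * (2 * q) - 0 :=
      ⟨q, by rw [hj]; push_cast; ring⟩
    simpa only [zpow_zero, Equiv.Perm.one_apply] using (zpow_apply_eq_zpow_apply_iff (σ * μ)).2 hdvd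
  · right
    rw [← zpow_natCast, zpow_apply_eq_zpow_apply_iff]
    exact ⟨q, by rw [hj]; push_cast; ring⟩

theorem eq_of_sameCycle_of_odd_period (hσ : Involutive σ) (hμ : Involutive μ) (hx : σ x = x)
    (hy : σ y = y) (hodd : Odd (MulAction.period (σ * μ) x)) (hxy : (σ * μ).SameCycle x y) :
    y = x := by
  obtain ⟨n, rfl⟩ := hxy
  rw [apply_zpow_apply_eq_zpow_apply_iff hσ hμ hx, ← two_mul] at hy
  have hcop : IsCoprime (MulAction.period (σ * μ) x : ℤ) 2 :=
    Nat.isCoprime_iff_coprime.2 hodd.coprime_two_right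
  have hdvd := hcop.dvd_of_dvd_mul_left hy
  rw [← sub_zero n, ← zpow_apply_eq_zpow_apply_iff] at hdvd
  simpa only [zpow_zero, Equiv.Perm.one_apply] using hdvd

theorem ncard_odd_period_le [Finite W] (hσ : Involutive σ) (hμ : Involutive μ) :
    {x | σ x = x ∧ Odd (MulAction.period (σ * μ) x)}.ncard ≤ {w | μ w = w}.ncard := by
  refine Set.ncard_le_ncard_of_injOn (fun x => ((σ * μ) ^ (MulAction.period (σ * μ) x / 2)) x) ?_ ?_
  · rintro x ⟨hx, hodd⟩
    rw [Set.mem_ofPred_eq, ← zpow_natCast, right_apply_zpow_apply_eq_self_iff hσ hμ hx]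
    exact_mod_cast (Nat.two_mul_div_two_add_one_of_odd hodd).symm.dvd
  · rintro x ⟨hx, hodd⟩ y ⟨hy, -⟩ hxy
    beta_reduce at hxy
    refine (eq_of_sameCycle_of_odd_period hσ hμ hx hy hodd ?_).symm
    rw [← Equiv.Perm.sameCycle_pow_right, ← hxy]
    exact Equiv.Perm.sameCycle_pow_right.2 (.refl _ _)

theorem ncard_even_period_le [Finite W] {γ : Type*} (hσ : Involutive σ) (hμ : Involutive μ)
    {F : W → γ} (hF : ∀ x y, σ x = x → F x = F y → (σ * μ).SameCycle x y) :
    {x | σ x = x ∧ Even (MulAction.period (σ * μ) x)}.ncard ≤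
      2 * (F '' {x | σ x = x ∧ Even (MulAction.period (σ * μ) x)}).ncard := by
  classical
  have hfin := Set.toFinite {x | σ x = x ∧ Even (MulAction.period (σ * μ) x)}
  rw [Set.ncard_eq_toFinset_card _ hfin, Set.ncard_eq_toFinset_card _ (hfin.image F),
    Set.Finite.toFinset_image F hfin]
  refine Finset.card_le_mul_card_image _ _ fun b hb => ?_
  obtain ⟨x, hx, rfl⟩ := Finset.mem_image.1 hb
  obtain ⟨hσx, j, hj⟩ := hfin.mem_toFinset.1 hx
  refine (Finset.card_le_card (t := {x, ((σ * μ) ^ j) x}) fun y hy => ?_).trans Finset.card_le_two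
  obtain ⟨hyE, hyx⟩ := Finset.mem_filter.1 hy
  rw [Finset.mem_insert, Finset.mem_singleton]
  exact eq_or_eq_of_sameCycle hσ hμ hσx (hfin.mem_toFinset.1 hyE).1 (hj.trans (two_mul j).symm)
    (hF x y hσx hyx.symm)

theorem ncard_fixed_le [Finite W] {γ : Type*} (hσ : Involutive σ) (hμ : Involutive μ)
    {F : W → γ} (hF : ∀ x y, σ x = x → F x = F y → (σ * μ).SameCycle x y) :
    {x | σ x = x}.ncard ≤ {w | μ w = w}.ncard +
      2 * (F '' {x | σ x = x ∧ Even (MulAction.period (σ * μ) x)}).ncard := by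
  have hunion : {x | σ x = x} = {x | σ x = x ∧ Odd (MulAction.period (σ * μ) x)} ∪
      {x | σ x = x ∧ Even (MulAction.period (σ * μ) x)} := by
    ext x
    have := (MulAction.period (σ * μ) x).even_or_odd
    simp only [Set.mem_ofPred_eq, Set.mem_union]
    tauto
  rw [hunion]
  exact (Set.ncard_union_le _ _).trans
    (add_le_add (ncard_odd_period_le hσ hμ) (ncard_even_period_le hσ hμ hF))

end Involutions

/-- The barrier `S` of the Tutte–Berge formula, together with odd components of `H - S`. The family
`𝒪` need not consist of all odd components, and its members may be unions of components. -/
structure IsOddSeparation {W : Type*} (H : SimpleGraph W) (S : Set W) (𝒪 : Set (Set W)) :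
    Prop where
  pairwiseDisjoint : 𝒪.PairwiseDisjoint id
  disjoint : ∀ C ∈ 𝒪, Disjoint C S
  odd_ncard : ∀ C ∈ 𝒪, Odd C.ncard
  mem_of_adj : ∀ C ∈ 𝒪, ∀ a ∈ C, ∀ b ∉ S, H.Adj a b → b ∈ C

section TutteBerge

variable {W : Type*} {H : SimpleGraph W} {S : Set W} {𝒪 : Set (Set W)}

theorem isOddSeparation_oddComponents (H : SimpleGraph W) (S : Set W) :
    IsOddSeparation H S ((Set.image Subtype.val ∘ SimpleGraph.ConnectedComponent.supp) ''
      ((⊤ : H.Subgraph).deleteVerts S).coe.oddComponents) where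
  pairwiseDisjoint := by
    rintro _ ⟨C, -, rfl⟩ _ ⟨D, -, rfl⟩ hCD
    exact (Set.disjoint_image_iff Subtype.val_injective).2
      (SimpleGraph.pairwise_disjoint_supp_connectedComponent _ (ne_of_apply_ne (_ ∘ _) hCD))
  disjoint := by
    rintro _ ⟨C, -, rfl⟩
    rw [Set.disjoint_left]
    rintro _ ⟨a, -, rfl⟩
    exact a.2.2
  odd_ncard := by
    rintro _ ⟨C, hC, rfl⟩
    rwa [comp_apply, Set.ncard_image_of_injective _ Subtype.val_injective]
  mem_of_adj := by
    rintro _ ⟨C, -, rfl⟩ _ ⟨a, ha, rfl⟩ b hb hab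
    refine ⟨⟨b, Set.mem_univ b, hb⟩, C.mem_supp_of_adj_mem_supp ha ?_, rfl⟩
    simpa [hb, a.2.2] using hab

theorem ncard_add_two_le_ncard_oddComponents [Finite W] (heven : Even (Nat.card W))
    (hS : H.IsTutteViolator S) :
    S.ncard + 2 ≤ ((⊤ : H.Subgraph).deleteVerts S).coe.oddComponents.ncard := by
  rw [SimpleGraph.IsTutteViolator] at hS
  have hparity := SimpleGraph.odd_ncard_oddComponents (G := ((⊤ : H.Subgraph).deleteVerts S).coe)
  have hcard : Nat.card ((⊤ : H.Subgraph).deleteVerts S).verts + S.ncard = Nat.card W := by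
    rw [Nat.card_coe_set_eq, SimpleGraph.Subgraph.deleteVerts_verts, SimpleGraph.Subgraph.verts_top,
      ← Set.compl_eq_univ_sdiff, add_comm, Set.ncard_add_ncard_compl]
  rw [← hcard] at heven
  grind

theorem exists_involutive_of_isPerfectMatching {M : H.Subgraph} (hM : M.IsPerfectMatching) :
    ∃ μ : Equiv.Perm W, Involutive μ ∧ ∀ w, H.Adj w (μ w) := by
  rw [SimpleGraph.Subgraph.isPerfectMatching_iff] at hM
  choose μ hμ hμ_unique using hM
  have hinv : Involutive μ := fun w => (hμ_unique (μ w) w (hμ w).symm).symm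
  exact ⟨hinv.toPerm, hinv, fun w => (hμ w).adj_sub⟩

theorem exists_involutive_or_exists_isOddSeparation [Finite W] (H : SimpleGraph W)
    (heven : Even (Nat.card W)) :
    (∃ μ : Equiv.Perm W, Involutive μ ∧ ∀ w, H.Adj w (μ w)) ∨
      ∃ S 𝒪, IsOddSeparation H S 𝒪 ∧ S.ncard + 2 ≤ 𝒪.ncard := by
  refine or_iff_not_imp_left.2 fun hno => ?_
  have hnot : ¬ ∃ M : H.Subgraph, M.IsPerfectMatching :=
    fun ⟨M, hM⟩ => hno (exists_involutive_of_isPerfectMatching hM)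
  rw [SimpleGraph.tutte] at hnot
  push Not at hnot
  obtain ⟨S, hS⟩ := hnot
  refine ⟨S, _, isOddSeparation_oddComponents H S, ?_⟩
  rw [Set.ncard_image_of_injective _
    (Subtype.val_injective.image_injective.comp SimpleGraph.ConnectedComponent.supp_injective)]
  exact ncard_add_two_le_ncard_oddComponents heven hS

theorem IsOddSeparation.mem_of_isUniversal (h : IsOddSeparation H S 𝒪) (h𝒪 : 2 ≤ 𝒪.ncard) {v : W}
    (hv : H.IsUniversal v) : v ∈ S := by
  by_contra hvS
  have hmem (C) (hC : C ∈ 𝒪) : v ∈ C := by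
    obtain ⟨a, ha⟩ := Set.nonempty_of_ncard_ne_zero (h.odd_ncard C hC).pos.ne'
    rcases eq_or_ne v a with rfl | hva
    · exact ha
    · exact h.mem_of_adj C hC a ha v hvS (hv hva).symm
  obtain ⟨C, hC, D, hD, hCD⟩ := (Set.one_lt_ncard_iff_nontrivial_and_finite.1 h𝒪).1
  exact Set.disjoint_left.1 (h.pairwiseDisjoint hC hD hCD) (hmem C hC) (hmem D hD)

/-- The join of `H` with a complete graph on `ι`. -/
def joinComplete (H : SimpleGraph W) (ι : Type*) : SimpleGraph (W ⊕ ι) :=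
  (Hᶜ ⊕g (⊥ : SimpleGraph ι))ᶜ

variable {ι : Type*}

theorem joinComplete_adj_inl {a b : W} :
    (joinComplete H ι).Adj (Sum.inl a) (Sum.inl b) ↔ H.Adj a b := by
  simp only [joinComplete, SimpleGraph.compl_adj, SimpleGraph.sum_adj_inl, ne_eq, Sum.inl.injEq,
    not_and, not_not]
  exact ⟨fun h => h.2 h.1, fun h => ⟨h.ne, fun _ => h⟩⟩

theorem isUniversal_joinComplete_inr (i : ι) : (joinComplete H ι).IsUniversal (Sum.inr i) := by
  rintro (w | j) hne <;> simp [joinComplete, hne]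

theorem exists_involutive_of_joinComplete [Finite ι] {ν : Equiv.Perm (W ⊕ ι)} (hν : Involutive ν)
    (hadj : ∀ w, (joinComplete H ι).Adj w (ν w)) :
    ∃ μ : Equiv.Perm W, Involutive μ ∧ (∀ w, μ w ≠ w → H.Adj w (μ w)) ∧
      {w | μ w = w}.ncard ≤ Nat.card ι := by
  let μ (w : W) : W := (ν (Sum.inl w)).elim id fun _ => w
  have hμ {w w'} (h : ν (Sum.inl w) = Sum.inl w') : μ w = w' := by
    simp only [μ, h, Sum.elim_inl, id]
  have hμ_self {w i} (h : ν (Sum.inl w) = Sum.inr i) : μ w = w := by simp only [μ, h, Sum.elim_inr]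
  have hinv : Involutive μ := fun w => by
    rcases h : ν (Sum.inl w) with w' | i
    · rw [hμ h, hμ (h ▸ hν _)]
    · rw [hμ_self h, hμ_self h]
  refine ⟨hinv.toPerm, hinv, fun w hw => ?_, ?_⟩
  · rcases h : ν (Sum.inl w) with w' | i
    · rw [hinv.coe_toPerm, hμ h, ← joinComplete_adj_inl (ι := ι), ← h]
      exact hadj _
    · exact absurd (hμ_self h) hw
  · have hmaps : (ν ∘ Sum.inl) '' {w | μ w = w} ⊆ Set.range Sum.inr := by
      rintro _ ⟨w, hw, rfl⟩
      rcases h : ν (Sum.inl w) with w' | i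
      · exact absurd (h.trans (congrArg _ ((hμ h).symm.trans hw))) (hadj _).ne'
      · exact ⟨i, h.symm⟩
    calc {w | μ w = w}.ncard
        = ((ν ∘ Sum.inl) '' {w | μ w = w}).ncard :=
          (Set.ncard_image_of_injective _ (ν.injective.comp Sum.inl_injective)).symm
      _ ≤ (Set.range Sum.inr).ncard := Set.ncard_le_ncard hmaps (Set.finite_range _)
      _ = Nat.card ι := Set.ncard_range_of_injective Sum.inr_injective

theorem IsOddSeparation.image_preimage_inl {S : Set (W ⊕ ι)} {𝒪 : Set (Set (W ⊕ ι))}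
    (h : IsOddSeparation (joinComplete H ι) S 𝒪) (hS : Set.range Sum.inr ⊆ S) {C : Set (W ⊕ ι)}
    (hC : C ∈ 𝒪) : Sum.inl '' (Sum.inl ⁻¹' C) = C := by
  refine Set.image_preimage_eq_of_subset ?_
  rw [← Set.compl_range_inr, Set.subset_compl_iff_disjoint_right]
  exact (h.disjoint C hC).mono_right hS

theorem IsOddSeparation.preimage_inl {S : Set (W ⊕ ι)} {𝒪 : Set (Set (W ⊕ ι))}
    (h : IsOddSeparation (joinComplete H ι) S 𝒪) (hS : Set.range Sum.inr ⊆ S) :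
    IsOddSeparation H (Sum.inl ⁻¹' S) (Set.preimage Sum.inl '' 𝒪) where
  pairwiseDisjoint := by
    rintro _ ⟨C, hC, rfl⟩ _ ⟨D, hD, rfl⟩ hCD
    exact (h.pairwiseDisjoint hC hD (ne_of_apply_ne _ hCD)).preimage _
  disjoint := by
    rintro _ ⟨C, hC, rfl⟩
    exact (h.disjoint C hC).preimage _
  odd_ncard := by
    rintro _ ⟨C, hC, rfl⟩
    rw [← Set.ncard_image_of_injective _ Sum.inl_injective, h.image_preimage_inl hS hC]
    exact h.odd_ncard C hC
  mem_of_adj := by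
    rintro _ ⟨C, hC, rfl⟩ a ha b hb hab
    exact h.mem_of_adj C hC _ ha _ hb (joinComplete_adj_inl.2 hab)

theorem tutte_berge [Finite W] (H : SimpleGraph W) {d : ℕ} (hd : Even (Nat.card W + d)) :
    (∃ μ : Equiv.Perm W, Involutive μ ∧ (∀ w, μ w ≠ w → H.Adj w (μ w)) ∧
      {w | μ w = w}.ncard ≤ d) ∨
      ∃ S 𝒪, IsOddSeparation H S 𝒪 ∧ S.ncard + d + 2 ≤ 𝒪.ncard := by
  have heven : Even (Nat.card (W ⊕ Fin d)) := by rwa [Nat.card_sum, Nat.card_fin]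
  rcases exists_involutive_or_exists_isOddSeparation (joinComplete H (Fin d)) heven with
    ⟨ν, hν, hadj⟩ | ⟨S, 𝒪, h, hcard⟩
  · simpa only [Nat.card_fin] using Or.inl (exists_involutive_of_joinComplete hν hadj)
  · have hS : Set.range Sum.inr ⊆ S := by
      rintro _ ⟨i, rfl⟩
      exact h.mem_of_isUniversal (by omega) (isUniversal_joinComplete_inr i)
    have hScard : S.ncard = (Sum.inl ⁻¹' S).ncard + d := by
      have hinr : Sum.inr ⁻¹' S = Set.univ := Set.eq_univ_of_forall fun i => hS ⟨i, rfl⟩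
      calc S.ncard = (Sum.inl '' (Sum.inl ⁻¹' S) ∪ Set.range Sum.inr).ncard := by
            rw [← Set.image_univ, ← hinr, Set.image_preimage_inl_union_image_preimage_inr]
        _ = (Sum.inl ⁻¹' S).ncard + d := by
            rw [Set.ncard_union_eq Set.disjoint_image_inl_range_inr,
              Set.ncard_image_of_injective _ Sum.inl_injective,
              Set.ncard_range_of_injective Sum.inr_injective, Nat.card_fin]
    refine Or.inr ⟨_, _, h.preimage_inl hS, ?_⟩
    have hinj : Set.InjOn (Set.preimage Sum.inl) 𝒪 :=
      Set.LeftInvOn.injOn fun C hC => h.image_preimage_inl hS hC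
    rwa [hinj.ncard_image, ← hScard]

end TutteBerge

/-- The vertices of the split graph of `X ⊆ α`: every vertex in `X` occurs once, and every other
vertex occurs as an out-copy (`true`) and as an in-copy (`false`). -/
abbrev SplitVert {α : Type*} (X : Set α) :=
  X ⊕ (Xᶜ : Set α) × Bool

namespace SplitVert

variable {α : Type*} {X : Set α} {u v : α} {b c : Bool} {w w' : SplitVert X}

open Classical in
/-- The out-copy (`b = true`) or in-copy (`b = false`) of `v`; both are `v` itself if `v ∈ X`. -/
noncomputable def copy (X : Set α) (b : Bool) (v : α) : SplitVert X :=
  if h : v ∈ X then Sum.inl ⟨v, h⟩ else Sum.inr (⟨v, h⟩, b)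

/-- The vertex of which `w` is a copy. -/
def base : SplitVert X → α :=
  Sum.elim Subtype.val fun p => p.1

/-- The involution exchanging the two copies of every vertex outside `X`. -/
def swap : Equiv.Perm (SplitVert X) :=
  (Equiv.refl X).sumCongr ((Equiv.refl _).prodCongr Equiv.boolNot)

@[simp]
theorem base_copy : base (copy X b v) = v := by
  by_cases h : v ∈ X <;> simp [copy, base, h]

@[simp]
theorem swap_copy : swap (copy X b v) = copy X (!b) v := by
  by_cases h : v ∈ X <;> simp [copy, swap, h]

theorem exists_eq_copy (w : SplitVert X) : ∃ b, w = copy X b (base w) := by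
  rcases w with ⟨v, hv⟩ | ⟨⟨v, hv : v ∉ X⟩, b⟩
  · exact ⟨true, by simp [copy, base, hv]⟩
  · exact ⟨b, by simp [copy, base, hv]⟩

theorem copy_eq_copy_iff : copy X b u = copy X c v ↔ u = v ∧ (u ∈ X ∨ b = c) := by
  by_cases hu : u ∈ X <;> by_cases hv : v ∈ X <;> simp [copy, hu, hv] <;> grind

theorem swap_involutive : Involutive (swap (X := X)) := fun w => by
  obtain ⟨b, hw⟩ := exists_eq_copy w
  rw [hw, swap_copy, swap_copy, Bool.not_not]

@[simp]
theorem base_swap : base (swap w) = base w := by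
  obtain ⟨b, hw⟩ := exists_eq_copy w
  rw [hw, swap_copy, base_copy, base_copy]

theorem swap_eq_self_iff : swap w = w ↔ base w ∈ X := by
  obtain ⟨b, hw⟩ := exists_eq_copy w
  rw [hw, swap_copy, copy_eq_copy_iff, base_copy]
  simp

theorem base_eq_base_iff : base w = base w' ↔ w = w' ∨ w = swap w' := by
  obtain ⟨b, hw⟩ := exists_eq_copy w
  obtain ⟨c, hw'⟩ := exists_eq_copy w'
  rw [hw, hw', swap_copy, copy_eq_copy_iff, copy_eq_copy_iff, base_copy, base_copy]
  cases b <;> cases c <;> simp <;> tauto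

theorem ncard_swap_eq_self : {w : SplitVert X | swap w = w}.ncard = X.ncard := by
  have hfix : {w : SplitVert X | swap w = w} = Set.range Sum.inl := by
    ext (w | ⟨w, b⟩) <;> simp [swap]
  rw [hfix, Set.ncard_range_of_injective Sum.inl_injective, Nat.card_coe_set_eq]

theorem even_card_add_ncard [Finite α] : Even (Nat.card (SplitVert X) + X.ncard) := by
  rw [Nat.card_sum, Nat.card_prod, Nat.card_coe_set_eq, Nat.card_eq_fintype_card (α := Bool),
    Fintype.card_bool]
  exact ⟨X.ncard + Nat.card (Xᶜ : Set α), by ring⟩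

end SplitVert

/-- The split graph, in which the two copies of each vertex outside `X` are matched to each other,
and an edge from `u` to `v` joins the out-copy of `u` to the in-copy of `v`. For an `X`-path, the
edges it traverses form an augmenting path for the matching of the two copies. -/
def splitGraph {α β : Type*} (X : Set α) (link : β → α → α → Prop) : SimpleGraph (SplitVert X) :=
  SimpleGraph.fromRel fun a b =>
    ∃ u v, a = .copy X true u ∧ b = .copy X false v ∧ (u = v ∨ ∃ e, link e u v)

section SplitGraph

variable {α β : Type*} {X : Set α} {link : β → α → α → Prop} {u v : α} {w w' : SplitVert X}

open SplitVert

/-- The edges as traversed in forward (`true`) or in backward (`false`) direction. -/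
def orient (link : β → α → α → Prop) (b : Bool) : β → α → α → Prop :=
  fun e u v => if b then link e u v else link e v u

theorem splitGraph_adj_swap (h : swap w ≠ w) : (splitGraph X link).Adj w (swap w) := by
  obtain ⟨b, hw⟩ := exists_eq_copy w
  refine (SimpleGraph.fromRel_adj _ _ _).2 ⟨h.symm, ?_⟩
  rw [hw, swap_copy]
  cases b
  · exact Or.inr ⟨_, _, rfl, rfl, Or.inl rfl⟩
  · exact Or.inl ⟨_, _, rfl, rfl, Or.inl rfl⟩

theorem splitGraph_adj_copy {e : β} (h : link e u v) (huv : u ≠ v) :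
    (splitGraph X link).Adj (copy X true u) (copy X false v) :=
  (SimpleGraph.fromRel_adj _ _ _).2
    ⟨fun h => huv (copy_eq_copy_iff.1 h).1, Or.inl ⟨u, v, rfl, rfl, Or.inr ⟨e, h⟩⟩⟩

theorem exists_of_splitGraph_adj (h : (splitGraph X link).Adj w w') (hne : base w ≠ base w') :
    ∃ b e, w = copy X b (base w) ∧ w' = copy X (!b) (base w') ∧
      orient link b e (base w) (base w') := by
  obtain ⟨-, ⟨u, v, rfl, rfl, he⟩ | ⟨u, v, rfl, rfl, he⟩⟩ := (SimpleGraph.fromRel_adj _ _ _).1 h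
  · simp only [base_copy] at hne
    obtain ⟨e, he⟩ := he.resolve_left hne
    exact ⟨true, e, by simpa [orient] using he⟩
  · simp only [base_copy] at hne
    obtain ⟨e, he⟩ := he.resolve_left hne.symm
    exact ⟨false, e, by simpa [orient] using he⟩

end SplitGraph

/-- The vertices outside `S` whose partner in the matching given by the involution `σ` is missing
or lies in `S`. -/
def matchingBoundary {W : Type*} (σ : Equiv.Perm W) (S : Set W) : Set W :=
  {w | w ∉ S ∧ (σ w = w ∨ σ w ∈ S)}

/-- The vertices of the edges of the matching `σ` inside `S`, and the boundary vertices that are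
not in the set `R` of representatives. -/
def matchingObstruction {W : Type*} (σ : Equiv.Perm W) (S R : Set W) : Set W :=
  {s ∈ S | σ s ∈ S} ∪ matchingBoundary σ S \ R

section HittingSet

variable {W : Type*} {H : SimpleGraph W} {σ : Equiv.Perm W} {S R C : Set W} {𝒪 : Set (Set W)}
  {t : Set W → W} {w w' : W}

theorem IsOddSeparation.inter_boundary_nonempty [Finite W] (h : IsOddSeparation H S 𝒪)
    (hσ : Involutive σ) (hadj : ∀ w, σ w ≠ w → H.Adj w (σ w)) (hC : C ∈ 𝒪) :
    (C ∩ matchingBoundary σ S).Nonempty := by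
  classical
  have := Fintype.ofFinite W
  by_contra hempty
  have hnot (w) (hw : w ∈ C) : σ w ≠ w ∧ σ w ∉ S := by
    have hwS : w ∉ S := Set.disjoint_left.1 (h.disjoint C hC) hw
    have : w ∉ matchingBoundary σ S := fun hwB => hempty ⟨w, hw, hwB⟩
    simpa only [matchingBoundary, Set.mem_ofPred_eq, hwS, not_false_eq_true, true_and, not_or]
      using this
  have hmaps (w) (hw : w ∈ C) : σ w ∈ C :=
    h.mem_of_adj C hC w hw _ (hnot w hw).2 (hadj w (hnot w hw).1)
  have hiff (w) : σ w ∈ C ↔ w ∈ C := ⟨fun hw => hσ w ▸ hmaps _ hw, hmaps w⟩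
  have hpow : σ.subtypePerm hiff ^ 2 ^ 1 = 1 := by
    ext w
    rw [pow_one, sq]
    exact hσ w
  have hcard : ¬ 2 ∣ Fintype.card C := by
    rw [← Nat.card_eq_fintype_card, Nat.card_coe_set_eq]
    exact (h.odd_ncard C hC).not_two_dvd_nat
  obtain ⟨w, hw⟩ := Equiv.Perm.exists_fixed_point_of_prime hcard hpow
  exact (hnot w w.2).1 (congrArg Subtype.val hw)

theorem ncard_matchingBoundary_le [Finite W] (hσ : Involutive σ) :
    (matchingBoundary σ S).ncard ≤ {s ∈ S | σ s ∉ S}.ncard + {w | σ w = w}.ncard := by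
  have hsub : matchingBoundary σ S ⊆ σ '' {s ∈ S | σ s ∉ S} ∪ {w | σ w = w} := by
    rintro w ⟨hwS, hw | hw⟩
    · exact Or.inr hw
    · exact Or.inl ⟨σ w, ⟨hw, by rwa [hσ w]⟩, hσ w⟩
  calc (matchingBoundary σ S).ncard ≤ _ := Set.ncard_le_ncard hsub
    _ ≤ _ := Set.ncard_union_le _ _
    _ = _ := by rw [Set.ncard_image_of_injective _ σ.injective]

theorem IsOddSeparation.ncard_matchingObstruction_add_le [Finite W] (h : IsOddSeparation H S 𝒪)
    (hσ : Involutive σ) (ht : ∀ C ∈ 𝒪, t C ∈ C ∩ matchingBoundary σ S) :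
    (matchingObstruction σ S (t '' 𝒪)).ncard + 𝒪.ncard ≤ S.ncard + {w | σ w = w}.ncard := by
  have ht_inj : Set.InjOn t 𝒪 := fun C hC D hD hCD =>
    h.pairwiseDisjoint.elim_set hC hD _ (ht C hC).1 (hCD ▸ (ht D hD).1)
  have ht_sub : t '' 𝒪 ⊆ matchingBoundary σ S := Set.image_subset_iff.2 fun C hC => (ht C hC).2
  have hunion := Set.ncard_union_le {s ∈ S | σ s ∈ S} (matchingBoundary σ S \ t '' 𝒪)
  have hsdiff := Set.ncard_sdiff_add_ncard_of_subset ht_sub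
  have hboundary := ncard_matchingBoundary_le (S := S) hσ
  have hS : {s ∈ S | σ s ∈ S}.ncard + {s ∈ S | σ s ∉ S}.ncard = S.ncard :=
    Set.ncard_inter_add_ncard_sdiff_eq_ncard S (σ ⁻¹' S)
  rw [ht_inj.ncard_image] at hsdiff
  rw [matchingObstruction]
  omega

theorem mem_of_mem_matchingBoundary (hw : w ∈ matchingBoundary σ S)
    (hwR : w ∉ matchingObstruction σ S R) : w ∈ R := by
  by_contra hno
  exact hwR (Or.inr ⟨hw, hno⟩)

theorem mem_of_apply_eq_self (hw : σ w = w) (hwR : w ∉ matchingObstruction σ S R) : w ∈ R :=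
  mem_of_mem_matchingBoundary ⟨fun hwS => hwR (Or.inl ⟨hwS, hw.symm ▸ hwS⟩), Or.inl hw⟩ hwR

-- An augmenting path that avoids the obstruction can enter an odd component only through its
-- representative, and can leave it only through a vertex of `S` with its partner outside `S`.
theorem IsOddSeparation.exists_mem_of_adj (h : IsOddSeparation H S 𝒪) (hσ : Involutive σ)
    (hadj : ∀ w, σ w ≠ w → H.Adj w (σ w)) (ht : ∀ C ∈ 𝒪, t C ∈ C ∩ matchingBoundary σ S)
    (hC : C ∈ 𝒪) (hw : w ∈ C) (hww' : H.Adj w w') (htw' : t C ≠ w')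
    (hw' : w' ∉ matchingObstruction σ S (t '' 𝒪)) (hσw' : σ w' ∉ matchingObstruction σ S (t '' 𝒪)) :
    σ w' ≠ w' ∧ ∃ D ∈ 𝒪, σ w' ∈ D ∧ (D = C ∨ t D = σ w') := by
  by_cases hw'S : w' ∈ S
  · have hσw'S : σ w' ∉ S := fun hmem => hw' (Or.inl ⟨hw'S, hmem⟩)
    obtain ⟨D, hD, htD⟩ :=
      mem_of_mem_matchingBoundary ⟨hσw'S, Or.inr (by rwa [hσ w'])⟩ hσw'
    exact ⟨(ne_of_mem_of_not_mem hw'S hσw'S).symm, D, hD, htD ▸ (ht D hD).1, Or.inr htD⟩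
  · have hw'C : w' ∈ C := h.mem_of_adj C hC w hw w' hw'S hww'
    have hboundary : w' ∉ matchingBoundary σ S := fun hmem => by
      obtain ⟨D, hD, htD⟩ := mem_of_mem_matchingBoundary hmem hw'
      have hDC : D = C := h.pairwiseDisjoint.elim_set hD hC _ (htD ▸ (ht D hD).1) hw'C
      exact htw' (hDC ▸ htD)
    have hne : σ w' ≠ w' := fun heq => hboundary ⟨hw'S, Or.inl heq⟩
    have hσw'S : σ w' ∉ S := fun hmem => hboundary ⟨hw'S, Or.inr hmem⟩
    exact ⟨hne, C, hC, h.mem_of_adj C hC w' hw'C _ hσw'S (hadj w' hne), Or.inl rfl⟩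

end HittingSet

section SplitGraph

variable {α β : Type*} {V X : Set α} {link : β → α → α → Prop}

open SplitVert

theorem MultiPath.IsXPath.support_inter_nonempty {P : MultiPath V link} (hP : P.IsXPath X)
    {S : Set (SplitVert X)} {𝒪 : Set (Set (SplitVert X))} {t : Set (SplitVert X) → SplitVert X}
    (h : IsOddSeparation (splitGraph X link) S 𝒪)
    (ht : ∀ C ∈ 𝒪, t C ∈ C ∩ matchingBoundary swap S) :
    (P.support ∩ base '' matchingObstruction swap S (t '' 𝒪)).Nonempty := by
  by_contra hempty
  obtain ⟨hlength, hfirst, hlast, -⟩ := hP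
  have havoid (i b) : copy X b (P.vert i) ∉ matchingObstruction swap S (t '' 𝒪) :=
    fun hmem => hempty ⟨P.vert i, ⟨i, rfl⟩, _, hmem, base_copy⟩
  let Reached (i : Fin (P.length + 1)) : Prop := ∃ C ∈ 𝒪, copy X true (P.vert i) ∈ C ∧
    ∃ j ≤ i, t C = copy X true (P.vert j)
  have hstep (i : Fin P.length) (hi : Reached i.castSucc) :
      P.vert i.succ ∉ X ∧ Reached i.succ := by
    obtain ⟨C, hC, hmem, j, hj, htC⟩ := hi
    have hne : P.vert i.castSucc ≠ P.vert i.succ :=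
      P.vert_injective.ne Fin.castSucc_lt_succ.ne
    have htC_ne : t C ≠ copy X false (P.vert i.succ) := fun heq =>
      (hj.trans_lt Fin.castSucc_lt_succ).ne
        (P.vert_injective (copy_eq_copy_iff.1 (htC.symm.trans heq)).1)
    obtain ⟨hnX, D, hD, hmemD, hDC⟩ := h.exists_mem_of_adj swap_involutive
      (fun _ => splitGraph_adj_swap) ht hC hmem (splitGraph_adj_copy (P.link_edge i) hne) htC_ne
      (havoid _ _) (by rw [swap_copy]; exact havoid _ _)
    rw [ne_eq, swap_eq_self_iff, base_copy] at hnX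
    rw [swap_copy, Bool.not_false] at hmemD hDC
    rcases hDC with rfl | htD
    · exact ⟨hnX, D, hD, hmemD, j, hj.trans Fin.castSucc_lt_succ.le, htC⟩
    · exact ⟨hnX, D, hD, hmemD, i.succ, le_rfl, htD⟩
  have hreach (i) : Reached i := by
    induction i using Fin.induction with
    | zero =>
      have hswap : swap (copy X true (P.vert 0)) = copy X true (P.vert 0) := by
        rwa [swap_eq_self_iff, base_copy]
      obtain ⟨C, hC, htC⟩ := mem_of_apply_eq_self hswap (havoid 0 true)
      exact ⟨C, hC, htC ▸ (ht C hC).1, 0, le_rfl, htC⟩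
    | succ i ih => exact (hstep i ih).2
  obtain ⟨i, hi⟩ := Fin.exists_succ_eq_of_ne_zero (x := Fin.last P.length)
    (Fin.pos_iff_ne_zero.1 hlength)
  exact (hstep i (hreach _)).1 (hi ▸ hlast)

end SplitGraph

section AlternatingPath

variable {α β : Type*} {V X : Set α} {link : β → α → α → Prop} {μ : Equiv.Perm (SplitVert X)}
  {x : SplitVert X} {m n : ℤ} {j : ℕ}

open SplitVert

/-- The cycles of `step μ` trace out the walks whose edges are alternately taken from the matching
`μ` and from the matching of the two copies of each vertex. -/
abbrev SplitVert.step (μ : Equiv.Perm (SplitVert X)) : Equiv.Perm (SplitVert X) :=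
  swap * μ

theorem base_zpow_apply_eq_iff (hμ : Involutive μ) (hx : swap x = x) :
    base ((step μ ^ m) x) = base ((step μ ^ n) x) ↔
      (MulAction.period (step μ) x : ℤ) ∣ m - n ∨ (MulAction.period (step μ) x : ℤ) ∣ m + n := by
  rw [base_eq_base_iff, zpow_apply_eq_zpow_apply_iff, eq_comm (b := swap _),
    apply_zpow_apply_eq_zpow_apply_iff swap_involutive hμ hx, add_comm n m]

theorem base_zpow_apply_mem_iff (hμ : Involutive μ) (hx : swap x = x) :
    base ((step μ ^ n) x) ∈ X ↔ (MulAction.period (step μ) x : ℤ) ∣ 2 * n := by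
  rw [← swap_eq_self_iff, apply_zpow_apply_eq_zpow_apply_iff swap_involutive hμ hx, two_mul]

theorem exists_orient_zpow_apply (hμ : Involutive μ)
    (hadj : ∀ w, μ w ≠ w → (splitGraph X link).Adj w (μ w)) (hx : swap x = x)
    (heven : Even (MulAction.period (step μ) x)) (n : ℤ) :
    ∃ b e, (step μ ^ n) x = copy X b (base ((step μ ^ n) x)) ∧
      (step μ ^ (n + 1)) x = copy X b (base ((step μ ^ (n + 1)) x)) ∧
      orient link b e (base ((step μ ^ n) x)) (base ((step μ ^ (n + 1)) x)) := by
  have hodd (k : ℤ) : ¬ (MulAction.period (step μ) x : ℤ) ∣ 2 * k + 1 := fun hdvd =>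
    Int.not_even_two_mul_add_one k
      (even_iff_two_dvd.2 ((Int.natCast_dvd_natCast.2 heven.two_dvd).trans hdvd))
  have hμ_ne : μ ((step μ ^ n) x) ≠ (step μ ^ n) x := by
    rw [ne_eq, right_apply_zpow_apply_eq_self_iff swap_involutive hμ hx]
    exact hodd n
  have hnext : (step μ ^ (n + 1)) x = swap (μ ((step μ ^ n) x)) := by
    rw [add_comm, zpow_one_add, Equiv.Perm.mul_apply, Equiv.Perm.mul_apply]
  have hbase : base ((step μ ^ n) x) ≠ base (μ ((step μ ^ n) x)) := by
    rw [← base_swap (w := μ _), ← hnext, ne_eq, base_zpow_apply_eq_iff hμ hx]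
    refine not_or.2 ⟨?_, ?_⟩
    · simpa using hodd (-1)
    · convert! hodd n using 2
      ring
  obtain ⟨b, e, hw, hw', he⟩ := exists_of_splitGraph_adj (hadj _ hμ_ne) hbase
  refine ⟨b, e, hw, ?_, ?_⟩
  · rw [hnext, base_swap, ← Bool.not_not b, ← swap_copy, ← hw']
  · rwa [hnext, base_swap]

theorem exists_forall_orient_zpow_apply (hμ : Involutive μ)
    (hadj : ∀ w, μ w ≠ w → (splitGraph X link).Adj w (μ w)) (hx : swap x = x)
    (hj : MulAction.period (step μ) x = 2 * j) :
    ∃ b, ∀ n < j, ∃ e,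
      orient link b e (base ((step μ ^ (n : ℤ)) x)) (base ((step μ ^ (n + 1 : ℤ)) x)) := by
  have heven : Even (MulAction.period (step μ) x) := hj ▸ even_two_mul j
  have hstep := exists_orient_zpow_apply hμ hadj hx heven
  obtain ⟨b, e, -, hend, he⟩ := hstep 0
  suffices h : ∀ n : ℕ, n < j → (step μ ^ (n + 1 : ℤ)) x =
      copy X b (base ((step μ ^ (n + 1 : ℤ)) x)) ∧ ∃ e,
      orient link b e (base ((step μ ^ (n : ℤ)) x)) (base ((step μ ^ (n + 1 : ℤ)) x)) from
    ⟨b, fun n hn => (h n hn).2⟩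
  intro n hn
  induction n with
  | zero => exact ⟨hend, e, he⟩
  | succ n ih =>
    obtain ⟨c, e, hstart, hend, he⟩ := hstep (n + 1)
    have hnX : base ((step μ ^ (n + 1 : ℤ)) x) ∉ X := by
      rw [base_zpow_apply_mem_iff hμ hx, hj]
      intro hdvd
      have := Int.le_of_dvd (by positivity) hdvd
      push_cast at this
      omega
    obtain rfl : b = c :=
      ((copy_eq_copy_iff.1 ((ih (by omega)).1.symm.trans hstart)).2.resolve_left hnX)
    push_cast
    exact ⟨hend, e, he⟩

theorem injOn_base_zpow_apply (hμ : Involutive μ) (hx : swap x = x)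
    (hj : MulAction.period (step μ) x = 2 * j) :
    Set.InjOn (fun n : ℕ => base ((step μ ^ (n : ℤ)) x)) (Set.Iic j) := by
  intro m hm n hn hmn
  rw [base_zpow_apply_eq_iff hμ hx, hj] at hmn
  simp only [Set.mem_Iic] at hm hn
  rcases hmn with hdvd | hdvd
  · have hsub := Int.eq_zero_of_abs_lt_dvd hdvd
    by_contra hne
    have := hsub (abs_lt.2 ⟨by push_cast; omega, by push_cast; omega⟩)
    omega
  · by_contra hne
    have := Int.le_of_dvd (by omega) hdvd
    push_cast at this
    omega

theorem base_image_sameCycle (hμ : Involutive μ) (hx : swap x = x)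
    (hj : MulAction.period (step μ) x = 2 * j) (hj_pos : 0 < j) :
    base '' {w | (step μ).SameCycle x w} =
      (fun n : ℕ => base ((step μ ^ (n : ℤ)) x)) '' Set.Iic j := by
  apply Set.Subset.antisymm
  · rintro _ ⟨_, ⟨n, rfl⟩, rfl⟩
    have hr_nonneg : 0 ≤ n % (2 * j) := Int.emod_nonneg _ (by omega)
    have hr_lt : n % (2 * j) < 2 * j := Int.emod_lt_of_pos _ (by omega)
    obtain hr | hr := le_total (n % (2 * j)) j
    · refine ⟨(n % (2 * j)).toNat, by simp only [Set.mem_Iic]; omega, ?_⟩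
      rw [base_zpow_apply_eq_iff hμ hx, hj]
      left
      push_cast
      rw [Int.toNat_of_nonneg hr_nonneg]
      exact ⟨-(n / (2 * j)), by rw [Int.emod_def]; ring⟩
    · refine ⟨(2 * j - n % (2 * j)).toNat, by simp only [Set.mem_Iic]; omega, ?_⟩
      rw [base_zpow_apply_eq_iff hμ hx, hj]
      right
      push_cast
      rw [Int.toNat_of_nonneg (by omega)]
      exact ⟨n / (2 * j) + 1, by rw [Int.emod_def]; ring⟩
  · rintro _ ⟨n, -, rfl⟩
    exact ⟨_, ⟨n, rfl⟩, rfl⟩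

/-- The reverse of a path, whose edges are traversed in the opposite direction. -/
def MultiPath.reverse (P : MultiPath V fun e u v => link e v u) : MultiPath V link where
  length := P.length
  vert := P.vert ∘ Fin.rev
  edge := P.edge ∘ Fin.rev
  vert_mem i := P.vert_mem i.rev
  vert_injective := P.vert_injective.comp Fin.rev_injective
  link_edge i := by
    rw [comp_apply, comp_apply, comp_apply, Fin.rev_castSucc, Fin.rev_succ]
    exact P.link_edge i.rev

@[simp]
theorem MultiPath.support_reverse (P : MultiPath V fun e u v => link e v u) :
    P.reverse.support = P.support :=
  Fin.rev_surjective.range_comp _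

theorem MultiPath.IsXPath.reverse {P : MultiPath V fun e u v => link e v u} (hP : P.IsXPath X) :
    P.reverse.IsXPath X := by
  obtain ⟨hlength, hfirst, hlast, hinner⟩ := hP
  refine ⟨hlength, ?_, ?_, fun i hi => ?_⟩
  · change P.vert (Fin.rev 0) ∈ X
    rwa [Fin.rev_zero]
  · change P.vert (Fin.last _).rev ∈ X
    rwa [Fin.rev_last]
  · rcases hinner i.rev hi with hi | hi
    · exact Or.inr ((Fin.rev_eq_iff.1 hi).trans (Fin.rev_zero _))
    · exact Or.inl ((Fin.rev_eq_iff.1 hi).trans (Fin.rev_last _))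

theorem exists_isXPath_support_eq (hμ : Involutive μ)
    (hadj : ∀ w, μ w ≠ w → (splitGraph X link).Adj w (μ w)) (hx : swap x = x)
    (heven : Even (MulAction.period (step μ) x)) (hpos : 0 < MulAction.period (step μ) x) :
    ∃ P : MultiPath Set.univ link, P.IsXPath X ∧
      P.support = base '' {w | (step μ).SameCycle x w} := by
  obtain ⟨j, hj⟩ := heven.two_dvd
  obtain ⟨b, hb⟩ := exists_forall_orient_zpow_apply hμ hadj hx hj
  choose e he using hb
  let P : MultiPath Set.univ (orient link b) :=
    { length := j
      vert := fun i => base ((step μ ^ ((i : ℕ) : ℤ)) x)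
      edge := fun i => e i i.is_lt
      vert_mem := fun i => Set.mem_univ _
      vert_injective := fun i i' h => Fin.ext <|
        injOn_base_zpow_apply hμ hx hj (Set.mem_Iic.2 i.is_le) (Set.mem_Iic.2 i'.is_le) h
      link_edge := fun i => by simpa using he i i.is_lt }
  have hmem (i : Fin (j + 1)) : P.vert i ∈ X ↔ i = 0 ∨ i = Fin.last j := by
    refine (base_zpow_apply_mem_iff hμ hx).trans ?_
    rw [hj, Nat.cast_mul, Nat.cast_ofNat, mul_dvd_mul_iff_left two_ne_zero, Int.natCast_dvd_natCast,
      Fin.ext_iff, Fin.ext_iff, Fin.val_last, Fin.val_zero]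
    exact ⟨fun hdvd => (Nat.eq_zero_or_pos _).imp_right fun hi =>
      (Nat.le_of_dvd hi hdvd).antisymm' i.is_le, by rintro (hi | hi) <;> simp [hi]⟩
  have hj_pos : 0 < j := by omega
  have hPX : P.IsXPath X :=
    ⟨hj_pos, (hmem 0).2 (Or.inl rfl), (hmem _).2 (Or.inr rfl), fun i => (hmem i).1⟩
  have hsupp : P.support = base '' {w | (step μ).SameCycle x w} := by
    rw [base_image_sameCycle hμ hx hj hj_pos]
    apply Set.Subset.antisymm
    · rintro _ ⟨i, rfl⟩
      exact ⟨i, i.is_le, rfl⟩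
    · rintro _ ⟨n, hn, rfl⟩
      exact ⟨⟨n, Nat.lt_succ_of_le hn⟩, rfl⟩
  cases b
  · exact ⟨P.reverse, hPX.reverse, P.support_reverse.trans hsupp⟩
  · exact ⟨P, hPX, hsupp⟩

end AlternatingPath

/-- The vertex sets of the `X`-paths. -/
def MultiPath.xPathSupports {α β : Type*} (V : Set α) (link : β → α → α → Prop) (X : Set α) :
    Set (Set α) :=
  {F | ∃ P : MultiPath V link, P.IsXPath X ∧ P.support = F}

section Finite

variable {α β : Type*} {V X : Set α} {link : β → α → α → Prop} {μ : Equiv.Perm (SplitVert X)}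
  {x y w w' : SplitVert X} {k : ℕ}

open SplitVert MultiPath

theorem sameCycle_of_base_eq (hμ : Involutive μ) (hx : swap x = x) (hxw : (step μ).SameCycle x w)
    (hyw' : (step μ).SameCycle y w') (h : base w = base w') : (step μ).SameCycle x y := by
  obtain ⟨n, rfl⟩ := hxw
  rcases base_eq_base_iff.1 h.symm with rfl | rfl
  · exact Equiv.Perm.SameCycle.trans ⟨n, rfl⟩ hyw'.symm
  · rw [apply_zpow_mul_apply swap_involutive hμ, hx] at hyw'
    exact Equiv.Perm.SameCycle.trans ⟨-n, rfl⟩ hyw'.symm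

theorem exists_isPacking_xPathSupports [Finite α] (hμ : Involutive μ)
    (hadj : ∀ w, μ w ≠ w → (splitGraph X link).Adj w (μ w))
    (hk : {w | μ w = w}.ncard + 2 * k ≤ X.ncard) :
    ∃ 𝓟, IsPacking (xPathSupports Set.univ link X) 𝓟 ∧ 𝓟.card = k := by
  classical
  let cycleBase (x : SplitVert X) : Set α := base '' {w | (step μ).SameCycle x w}
  let E : Set (SplitVert X) := {x | swap x = x ∧ Even (MulAction.period (step μ) x)}
  have hcycle (x y) (hx : swap x = x) (hxy : cycleBase x = cycleBase y) :
      (step μ).SameCycle x y := by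
    have hmem : base x ∈ cycleBase x := ⟨x, .refl _ _, rfl⟩
    rw [hxy] at hmem
    obtain ⟨w, hw, hwx⟩ := hmem
    exact sameCycle_of_base_eq hμ hx (.refl _ _) hw hwx.symm
  have hcard : k ≤ (cycleBase '' E).ncard := by
    have hfixed := ncard_fixed_le swap_involutive hμ hcycle
    rw [ncard_swap_eq_self] at hfixed
    change _ ≤ _ + 2 * (cycleBase '' E).ncard at hfixed
    omega
  obtain ⟨𝓟, h𝓟, h𝓟k⟩ := Set.exists_subset_card_eq hcard
  obtain ⟨𝓟, rfl⟩ := ((Set.toFinite (cycleBase '' E)).subset h𝓟).exists_finset_coe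
  refine ⟨𝓟, ⟨h𝓟.trans ?_, ?_⟩, by rwa [Set.ncard_coe_finset] at h𝓟k⟩
  · rintro _ ⟨x, ⟨hx, heven⟩, rfl⟩
    exact exists_isXPath_support_eq hμ hadj hx heven (MulAction.period_pos_of_orderOf_pos
      (orderOf_pos _) x)
  · intro A hA B hB hAB
    obtain ⟨x, hx, rfl⟩ := h𝓟 hA
    obtain ⟨y, -, rfl⟩ := h𝓟 hB
    refine Set.disjoint_left.2 ?_
    rintro _ ⟨w, hw, rfl⟩ ⟨w', hw', hww'⟩
    have hxy := sameCycle_of_base_eq hμ hx.1 hw hw' hww'.symm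
    exact hAB (congrArg (base '' ·) (Set.ext fun w => ⟨hxy.symm.trans, hxy.trans⟩))

theorem MultiPath.IsXPath.exists_mem_of_ne {P : MultiPath V link} (hP : P.IsXPath X) (x : α) :
    ∃ v ∈ P.support, v ∈ X ∧ v ≠ x := by
  obtain ⟨hlength, hfirst, hlast, -⟩ := hP
  have hne : P.vert 0 ≠ P.vert (Fin.last _) := P.vert_injective.ne (Fin.ne_of_lt hlength)
  obtain h | h := eq_or_ne (P.vert 0) x
  · exact ⟨_, ⟨_, rfl⟩, hlast, h ▸ hne.symm⟩
  · exact ⟨_, ⟨_, rfl⟩, hfirst, h⟩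

theorem hasPackingOrTransversal_of_ncard_lt [Finite α] (hk : X.ncard < 2 * k) :
    HasPackingOrTransversal (xPathSupports V link X) k (2 * k - 2) := by
  classical
  right
  obtain rfl | ⟨x, hx⟩ := X.eq_empty_or_nonempty
  · refine ⟨∅, Nat.zero_le _, ?_⟩
    rintro _ ⟨P, hP, rfl⟩
    exact hP.2.1.elim
  · refine ⟨(X \ {x}).toFinite.toFinset, ?_, ?_⟩
    · rw [← Set.ncard_eq_toFinset_card, Set.ncard_sdiff_singleton_of_mem hx]
      omega
    · rintro _ ⟨P, hP, rfl⟩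
      obtain ⟨v, hv, hvX, hvx⟩ := hP.exists_mem_of_ne x
      exact ⟨v, hv, by simpa using ⟨hvX, hvx⟩⟩

theorem hasPackingOrTransversal_xPathSupports_univ [Finite α] (hk : 0 < k) :
    HasPackingOrTransversal (xPathSupports Set.univ link X) k (2 * k - 2) := by
  classical
  obtain hX | hX := lt_or_ge X.ncard (2 * k)
  · exact hasPackingOrTransversal_of_ncard_lt hX
  obtain ⟨d, hd⟩ := Nat.exists_eq_add_of_le' hX
  have heven : Even (Nat.card (SplitVert X) + d) := by
    have := even_card_add_ncard (X := X)
    rw [hd, ← add_assoc] at this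
    exact (Nat.even_add.1 this).2 (even_two_mul k)
  rcases tutte_berge (splitGraph X link) heven with ⟨μ, hμ, hadj, hμd⟩ | ⟨S, 𝒪, hS, hcard⟩
  · exact Or.inl (exists_isPacking_xPathSupports hμ hadj (by omega))
  · have hX_nonempty := Set.nonempty_of_ncard_ne_zero (s := X) (by omega)
    have : Nonempty (SplitVert X) := hX_nonempty.to_subtype.map Sum.inl
    choose! t ht using fun C (hC : C ∈ 𝒪) =>
      hS.inter_boundary_nonempty swap_involutive (fun _ => splitGraph_adj_swap) hC
    have hobstruction := hS.ncard_matchingObstruction_add_le swap_involutive ht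
    rw [ncard_swap_eq_self] at hobstruction
    refine Or.inr ⟨(Set.toFinite (base '' matchingObstruction swap S (t '' 𝒪))).toFinset, ?_, ?_⟩
    · rw [← Set.ncard_eq_toFinset_card]
      exact (Set.ncard_image_le (Set.toFinite _)).trans (by omega)
    · rintro _ ⟨P, hP, rfl⟩
      rw [Set.Finite.coe_toFinset]
      exact hP.support_inter_nonempty hS ht

end Finite

section Restriction

variable {α β : Type*} {V U X : Set α} {link : β → α → α → Prop} {k : ℕ}

open MultiPath

theorem MultiPath.support_subset (P : MultiPath V link) : P.support ⊆ V :=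
  Set.range_subset_iff.2 P.vert_mem

theorem sep_xPathSupports_subset_eq_image (hUV : U ⊆ V) :
    {F ∈ xPathSupports V link X | F ⊆ U} = Set.image (↑) ''
      xPathSupports (Set.univ : Set U) (fun e u v => link e u v) ((↑) ⁻¹' X) := by
  apply Set.Subset.antisymm
  · rintro _ ⟨⟨P, hP, rfl⟩, hPU⟩
    let Q : MultiPath (Set.univ : Set U) (fun e u v => link e u v) :=
      { P with
        vert := fun i => ⟨P.vert i, hPU ⟨i, rfl⟩⟩
        vert_mem := fun i => Set.mem_univ _
        vert_injective := fun i j h => P.vert_injective (congrArg Subtype.val h) }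
    exact ⟨_, ⟨Q, hP, rfl⟩, (Set.range_comp _ _).symm⟩
  · rintro _ ⟨_, ⟨P, hP, rfl⟩, rfl⟩
    let Q : MultiPath V link :=
      { P with
        vert := fun i => P.vert i
        vert_mem := fun i => hUV (P.vert i).2
        vert_injective := Subtype.val_injective.comp P.vert_injective }
    exact ⟨⟨Q, hP, Set.range_comp Subtype.val P.vert⟩, Subtype.coe_image_subset _ _⟩

theorem hasPackingOrTransversal_xPathSupports (hk : 0 < k) :
    HasPackingOrTransversal (xPathSupports V link X) k (2 * k - 2) := by
  refine hasPackingOrTransversal_of_forall_finite ?_ fun U hU => ?_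
  · rintro _ ⟨P, -, rfl⟩
    exact Set.finite_range _
  · have hinter : {F ∈ xPathSupports V link X | F ⊆ U} =
        {F ∈ xPathSupports V link X | F ⊆ U ∩ V} := by
      ext F
      refine and_congr_right ?_
      rintro ⟨P, -, rfl⟩
      rw [Set.subset_inter_iff, and_iff_left P.support_subset]
    have : Finite ↥(U ∩ V) := (hU.inter_of_left V).to_subtype
    rw [hinter, sep_xPathSupports_subset_eq_image Set.inter_subset_right]
    exact (hasPackingOrTransversal_xPathSupports_univ hk).image Subtype.val_injective

end Restriction

section Multigraph

variable {α β : Type*} {V X Y : Set α} {link link' : β → α → α → Prop}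

theorem exists_xPaths_of_isPacking
    {𝓟 : Finset (Set α)} (h : IsPacking (MultiPath.xPathSupports V link X) 𝓟) :
    ∃ Ps : Finset (MultiPath V link), Ps.card = 𝓟.card ∧ (∀ P ∈ Ps, P.IsXPath X) ∧
      ∀ P ∈ Ps, ∀ Q ∈ Ps, P ≠ Q → Disjoint P.support Q.support := by
  classical
  choose P hP hPF using fun F : 𝓟 => h.1 F.2
  have hP_inj : Injective P := fun F F' hFF' =>
    Subtype.ext ((hPF F).symm.trans ((congrArg MultiPath.support hFF').trans (hPF F')))
  refine ⟨Finset.univ.image P, ?_, ?_, ?_⟩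
  · rw [Finset.card_image_of_injective _ hP_inj, Finset.card_univ, Fintype.card_coe]
  · exact Finset.forall_mem_image.2 fun F _ => hP F
  · intro A hA B hB hAB
    obtain ⟨F, -, rfl⟩ := Finset.mem_image.1 hA
    obtain ⟨F', -, rfl⟩ := Finset.mem_image.1 hB
    rw [hPF, hPF]
    exact h.2 F.2 F'.2 fun hFF' => hAB (congrArg P (Subtype.ext hFF'))

theorem not_exists_isXPath_sdiff (hlink : ∀ e x y, link' e x y → link e x y)
    (hY : ∀ P : MultiPath V link, P.IsXPath X → (P.support ∩ Y).Nonempty) :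
    ¬ ∃ P : MultiPath (V \ Y) link', P.IsXPath X := by
  rintro ⟨P, hP⟩
  let Q : MultiPath V link :=
    { P with
      vert_mem := fun i => (P.vert_mem i).1
      link_edge := fun i => hlink _ _ _ (P.link_edge i) }
  obtain ⟨_, ⟨i, rfl⟩, hiY⟩ := hY Q hP
  exact (P.vert_mem i).2 hiY

theorem corollary5p2_general (V : Set α) (link : β → α → α → Prop) (X : Set α) (k : ℕ) :
    (∃ Ps : Finset (MultiPath V link), Ps.card = k ∧ (∀ P ∈ Ps, P.IsXPath X) ∧
      ∀ P ∈ Ps, ∀ Q ∈ Ps, P ≠ Q → Disjoint P.support Q.support) ∨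
    (∃ Y : Finset α, (Y : Set α) ⊆ V ∧ (Y.card : ℤ) ≤ 2 * (k : ℤ) - 2 ∧
      ∀ P : MultiPath V link, P.IsXPath X → (P.support ∩ Y).Nonempty) := by
  classical
  obtain rfl | hk := k.eq_zero_or_pos
  · exact Or.inl ⟨∅, by simp⟩
  refine (hasPackingOrTransversal_xPathSupports (V := V) (link := link) (X := X) hk).imp ?_ ?_
  · rintro ⟨𝓟, h𝓟, rfl⟩
    exact exists_xPaths_of_isPacking h𝓟
  · rintro ⟨T, hT, hTP⟩
    refine ⟨{v ∈ T | v ∈ V}, fun v hv => (Finset.mem_filter.1 hv).2, ?_, fun P hP => ?_⟩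
    · have := Finset.card_filter_le T (· ∈ V)
      omega
    · obtain ⟨v, hvP, hvT⟩ := hTP P.support ⟨P, hP, rfl⟩
      exact ⟨v, hvP, Finset.mem_filter.2 ⟨hvT, P.support_subset hvP⟩⟩

end Multigraph

theorem corollary5p2 {α : Type u} {β : Type v} :
    -- undirected multigraphs
    (∀ (G : Graph α β) (X : Set α), X ⊆ G.vertexSet → ∀ k : ℕ,
      (∃ Ps : Finset G.Path, Ps.card = k ∧ (∀ P ∈ Ps, P.IsXPath X) ∧
        ∀ P ∈ Ps, ∀ Q ∈ Ps, P ≠ Q → Disjoint P.support Q.support) ∨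
      (∃ Y : Finset α, (Y : Set α) ⊆ G.vertexSet ∧ (Y.card : ℤ) ≤ 2 * (k : ℤ) - 2 ∧
        ¬ ∃ P : (G.deleteVerts (Y : Set α)).Path, P.IsXPath X)) ∧
    -- directed multigraphs
    (∀ (D : MultiDigraph α β) (X : Set α), X ⊆ D.vertexSet → ∀ k : ℕ,
      (∃ Ps : Finset D.Path, Ps.card = k ∧ (∀ P ∈ Ps, P.IsXPath X) ∧
        ∀ P ∈ Ps, ∀ Q ∈ Ps, P ≠ Q → Disjoint P.support Q.support) ∨
      (∃ Y : Finset α, (Y : Set α) ⊆ D.vertexSet ∧ (Y.card : ℤ) ≤ 2 * (k : ℤ) - 2 ∧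
        ¬ ∃ P : (D.deleteVerts (Y : Set α)).Path, P.IsXPath X)) := by
  refine ⟨fun G X _ k => ?_, fun D X _ k => ?_⟩
  · refine (corollary5p2_general G.vertexSet G.IsLink X k).imp_right ?_
    rintro ⟨Y, hYV, hYk, hY⟩
    exact ⟨Y, hYV, hYk,
      not_exists_isXPath_sdiff (fun e x y h => ((G.deleteVerts_isLink _).1 h).1) hY⟩
  · refine (corollary5p2_general D.vertexSet D.IsArc X k).imp_right ?_
    rintro ⟨Y, hYV, hYk, hY⟩
    exact ⟨Y, hYV, hYk, not_exists_isXPath_sdiff (fun e x y h => h.1) hY⟩
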